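/- **Theorem 3.6.** Let $X,Y$ be finite-dimensional complex Hilbert spaces, let $\Gamma$ be a discrete abelian group, written multiplicatively, and let $G=(V,E)$ be a simple undirected graph whose vertex set is finite or countably infinite. *Symmetric frameworks.* Let $\varphi=(\varphi_{v,w})_{v,w\in V}$ be linear maps $X\to Y$ with $\varphi_{v,w}=0$ if $vw\notin E$ and $\varphi_{v,w}=-\varphi_{w,v}$ if $vw\in E$. Let $\theta:\Gamma\to\operatorname{Aut}(G)$ be a homomorphism; write $\gamma v=\theta(\gamma)v$ and $\gamma(vw)=(\gamma v)(\gamma w)$. Let $\tau$ be a homomorphism from $\Gamma$ to the group of (complex) affine isometries of $X$, and let $d\tau(\gamma)\in U(X)$ be the linear part of $\tau(\gamma)$. Suppose that $$\varphi_{\gamma v,\gamma w}=\varphi_{v,w}\circ d\tau(\gamma^{-1})\qquad(\gamma\in\Gamma,\ v,w\in V).$$ Suppose that $\theta$ acts freely on vertices and edges ($\gamma v\ne v$ and $\gamma e\neq e$ for $\gamma\neq 1$, $v\in V$, $e\in E$), and that the sets $V_0$ and $E_0$ of vertex and edge orbits are finite. *Gain graph.* Choose a representative $\tilde v\in V$ of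 each vertex orbit $[v]\in V_0$, an orientation $[e]=([v],[w])$ of each edge orbit $[e]\in E_0$, and for each $[e]$ a gain $\gamma\in\Gamma$ such that $\tilde e:=\tilde v(\gamma\tilde w)$ is an edge in $[e]$. *Operators.* Give $X^{V_0}$ and $Y^{E_0}$ their Hilbert space ($\ell^2$) norms. Let - $C(G,\varphi):X^V\to Y^E$, $(x_v)_{v\in V}\mapsto(\varphi_{v,w}(x_v-x_w))_{vw\in E}$, be the linear map of the coboundary matrix; - $S_V:\ell^2(V,X)\to\ell^2(\Gamma,X^{V_0})$, $S_V(z)_\gamma=(z_{\gamma\tilde v})_{[v]\in V_0}$, and $S_E:\ell^2(E,Y)\to\ell^2(\Gamma,Y^{E_0})$, $S_E(z)_\gamma=(z_{\gamma\tilde e})_{[e]\in E_0}$, which are isometric isomorphisms; - $\tilde\tau(\gamma)x=(d\tau(\gamma)x_{[v]})_{[v]\in V_0}$ for $x\in X^{V_0}$, and $(T_{\tilde\tau}f)(\gamma)=\tilde\tau(\gamma^{-1})f(\gamma)$ for $f\in\ell^2(\Gamma,X^{V_0})$; - $F_H:\ell^2(\Gamma,H)\to L^2(\hat\Gamma,H)$,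 for a Hilbert space $H$, be the unitary Fourier transform extending $\hat f(\xi)=\sum_{\gamma}\overline{\xi(\gamma)}f(\gamma)$ from $\ell^1\cap\ell^2$, where the compact dual group $\hat\Gamma$ carries Haar measure of total mass $1$; - $M_\Phi:L^2(\hat\Gamma,X^{V_0})\to L^2(\hat\Gamma,Y^{E_0})$, $(M_\Phi f)(\xi)=\Phi(\xi)f(\xi)$ a.e., for $\Phi\in L^\infty(\hat\Gamma,B(X^{V_0},Y^{E_0}))$. Then $C(G,\varphi)$ restricts to a bounded operator $\ell^2(V,X)\to\ell^2(E,Y)$, and there exists $\Phi\in L^\infty(\hat\Gamma,B(X^{V_0},Y^{E_0}))$ (a symbol function) such that $$C(G,\varphi)=S_E^{-1}\circ F_{Y^{E_0}}^{-1}\circ M_\Phi\circ F_{X^{V_0}}\circ T_{\tilde\tau}\circ S_V .$$ -/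

import Mathlib

set_option linter.unusedSectionVars false

open MeasureTheory
open scoped ENNReal

/-! ### Harmonic analysis on the dual of a discrete abelian group -/

namespace SymbolFunction

section Dual

variable {Γ : Type*} [CommGroup Γ] [TopologicalSpace Γ] [DiscreteTopology Γ]

/-- The dual group carries its Borel σ-algebra. -/
noncomputable instance dualMeasurableSpace : MeasurableSpace (PontryaginDual Γ) := borel _

instance dualBorelSpace : BorelSpace (PontryaginDual Γ) := ⟨rfl⟩

variable (Γ) in
/-- Haar measure on the compact dual group, normalised to have total mass one. This is the measure
dual to the counting measure of the discrete group. -/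
noncomputable def dualHaar : Measure (PontryaginDual Γ) :=
  Measure.haarMeasure (⊤ : TopologicalSpace.PositiveCompacts (PontryaginDual Γ))

instance : (dualHaar Γ).IsHaarMeasure := by unfold dualHaar; infer_instance

instance : (dualHaar Γ).Regular := by unfold dualHaar; infer_instance

instance : IsProbabilityMeasure (dualHaar Γ) :=
  ⟨by
    have h := Measure.haarMeasure_self
      (K₀ := (⊤ : TopologicalSpace.PositiveCompacts (PontryaginDual Γ)))
    simpa [dualHaar] using h⟩

theorem continuous_eval (γ : Γ) : Continuous fun ξ : PontryaginDual Γ => (ξ γ : ℂ) := by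
  have h : Continuous fun ξ : Γ →ₜ* Circle => ξ.toContinuousMap γ :=
    (ContinuousEvalConst.continuous_eval_const (F := C(Γ, Circle)) γ).comp
      (ContinuousMonoidHom.isInducing_toContinuousMap Γ Circle).continuous
  exact continuous_subtype_val.comp h

/-- The continuous function `ξ ↦ conj (ξ γ) • x` on the dual group. -/
noncomputable def conjChar {H : Type*} [NormedAddCommGroup H] [NormedSpace ℂ H] (γ : Γ) (x : H) :
    C(PontryaginDual Γ, H) where
  toFun ξ := (starRingEnd ℂ) (ξ γ : ℂ) • x
  continuous_toFun := by
    have h := continuous_eval γ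
    exact (Complex.continuous_conj.comp h).smul continuous_const

theorem norm_conjChar_apply {H : Type*} [NormedAddCommGroup H] [NormedSpace ℂ H] (γ : Γ) (x : H)
    (ξ : PontryaginDual Γ) : ‖conjChar γ x ξ‖ = ‖x‖ := by
  have h : ‖(ξ γ : ℂ)‖ = 1 := Circle.norm_coe _
  simp [conjChar, norm_smul, h]

theorem exists_dual_ne_one {γ : Γ} (h : γ ≠ 1) : ∃ ξ : PontryaginDual Γ, ξ γ ≠ 1 := by
  have h0 : (Additive.ofMul γ) ≠ 0 := by simpa using h
  obtain ⟨c, hc⟩ := CharacterModule.exists_character_apply_ne_zero_of_ne_zero h0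
  let k : AddCircle (1 : ℚ) →+ AddCircle (1 : ℝ) :=
    QuotientAddGroup.map _ _ (Rat.castHom ℝ).toAddMonoidHom (by
      rw [AddSubgroup.zmultiples_le]
      exact AddSubgroup.mem_comap.2 (by simp))
  have hk : ∀ a, k a = 0 → a = 0 := by
    intro a
    induction a using QuotientAddGroup.induction_on with
    | H q =>
      intro hq
      have hq' : ((q : ℝ) : AddCircle (1 : ℝ)) = 0 := hq
      rw [AddCircle.coe_eq_zero_iff] at hq'
      obtain ⟨n, hn⟩ := hq'
      refine (AddCircle.coe_eq_zero_iff (1 : ℚ)).2 ⟨n, ?_⟩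
      have : ((n : ℚ) : ℝ) = (q : ℝ) := by simpa using hn
      have h3 : (n : ℚ) = q := by exact_mod_cast this
      simpa using h3
  let f : Γ →* Circle :=
    { toFun := fun g => AddCircle.toCircle (k (c (Additive.ofMul g)))
      map_one' := by simp
      map_mul' := fun a b => by simp [AddCircle.toCircle_add] }
  refine ⟨(⟨f, continuous_of_discreteTopology⟩ : Γ →ₜ* Circle), fun h1 => hc (hk _ ?_)⟩
  have h2 : AddCircle.toCircle (k (c (Additive.ofMul γ))) = 1 := h1
  apply AddCircle.injective_toCircle one_ne_zero
  rw [h2, AddCircle.toCircle_zero]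

theorem integral_eval_eq_zero {γ : Γ} (h : γ ≠ 1) :
    ∫ ξ : PontryaginDual Γ, (ξ γ : ℂ) ∂dualHaar Γ = 0 := by
  obtain ⟨η, hη⟩ := exists_dual_ne_one h
  have h1 := integral_mul_left_eq_self (μ := dualHaar Γ)
    (fun ξ : PontryaginDual Γ => (ξ γ : ℂ)) η
  have h2 : ∀ ξ : PontryaginDual Γ, ((η * ξ) γ : Circle) = η γ * ξ γ := fun ξ => rfl
  simp only [h2, Circle.coe_mul, integral_const_mul] at h1
  have h3 : (η γ : ℂ) ≠ 1 := fun h => hη (Circle.ext (by simpa using h))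
  have h4 : ((η γ : ℂ) - 1) * ∫ ξ : PontryaginDual Γ, (ξ γ : ℂ) ∂dualHaar Γ = 0 := by
    rw [sub_mul, h1]; ring
  exact (mul_eq_zero.1 h4).resolve_left (sub_ne_zero.2 h3)

section Fourier

variable {H : Type*} [NormedAddCommGroup H] [InnerProductSpace ℂ H]

theorem memLp_conjChar (γ : Γ) (x : H) : MemLp (conjChar γ x) 2 (dualHaar Γ) := by
  refine MemLp.of_bound ?_ ‖x‖ (Filter.Eventually.of_forall fun ξ => ?_)
  · exact (Complex.continuous_conj.comp (continuous_eval γ)).aestronglyMeasurable.smul_const x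
  · exact (norm_conjChar_apply γ x ξ).le

/-- The isometric embedding `x ↦ (ξ ↦ conj (ξ γ) • x)` of `H` into `L²(Γ̂, H)`. -/
noncomputable def charEmbedding (γ : Γ) : H →ₗᵢ[ℂ] Lp H 2 (dualHaar Γ) where
  toFun x := (memLp_conjChar γ x).toLp _
  map_add' x y := by
    rw [← MemLp.toLp_add]; congr 1; ext ξ; simp [conjChar]
  map_smul' c x := by
    rw [RingHom.id_apply, ← MemLp.toLp_const_smul]; congr 1; ext ξ; simp [conjChar, smul_comm c]
  norm_map' x := by
    have h2 : ∀ᵐ ξ ∂dualHaar Γ, ‖conjChar γ x ξ‖ = ‖x‖ :=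
      Filter.Eventually.of_forall fun ξ => norm_conjChar_apply γ x ξ
    have h3 := eLpNorm_congr_norm_ae (p := 2) (g := fun _ => x) h2
    simp only [LinearMap.coe_mk, AddHom.coe_mk]
    rw [Lp.norm_toLp, h3, eLpNorm_const x (by simp) (NeZero.ne _)]
    simp

theorem charEmbedding_coeFn (γ : Γ) (x : H) :
    charEmbedding γ x =ᵐ[dualHaar Γ] conjChar γ x := (memLp_conjChar γ x).coeFn_toLp

theorem orthogonalFamily_charEmbedding :
    OrthogonalFamily ℂ (fun _ : Γ => H) (fun γ : Γ => charEmbedding (H := H) γ) := by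
  intro γ γ' hne x y
  rw [L2.inner_def]
  have h3 : ∀ᵐ ξ ∂dualHaar Γ, inner ℂ ((charEmbedding γ x : Lp H 2 (dualHaar Γ)) ξ)
      ((charEmbedding γ' y : Lp H 2 (dualHaar Γ)) ξ) =
        (ξ (γ * γ'⁻¹) : ℂ) * inner ℂ x y := by
    filter_upwards [charEmbedding_coeFn γ x, charEmbedding_coeFn γ' y] with ξ e1 e2
    rw [e1, e2]
    simp only [conjChar, ContinuousMap.coe_mk, inner_smul_left, inner_smul_right,
      Complex.conj_conj, map_mul, map_inv, Circle.coe_mul, Circle.coe_inv_eq_conj]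
    ring
  rw [integral_congr_ae h3, integral_mul_const, integral_eval_eq_zero, zero_mul]
  rwa [Ne, mul_inv_eq_one]

theorem span_conjChar_dense :
    (Submodule.span ℂ (Set.range fun γ : Γ => conjChar γ (1 : ℂ))).topologicalClosure = ⊤ := by
  let A : StarSubalgebra ℂ C(PontryaginDual Γ, ℂ) :=
    { toSubalgebra := Algebra.adjoin ℂ (Set.range fun γ : Γ => conjChar γ (1 : ℂ))
      star_mem' := by
        change Algebra.adjoin ℂ (Set.range fun γ : Γ => conjChar γ (1 : ℂ)) ≤
          star (Algebra.adjoin ℂ (Set.range fun γ : Γ => conjChar γ (1 : ℂ)))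
        refine Algebra.adjoin_le ?_
        rintro - ⟨γ, rfl⟩
        refine Algebra.subset_adjoin ⟨γ⁻¹, ?_⟩
        ext ξ
        simp [conjChar, ← Circle.coe_inv_eq_conj] }
  have hA : A.topologicalClosure = ⊤ := by
    apply ContinuousMap.starSubalgebra_topologicalClosure_eq_top_of_separatesPoints
    intro ξ η hne
    obtain ⟨γ, hγ⟩ : ∃ γ : Γ, ξ γ ≠ η γ := by
      by_contra! h
      exact hne (PontryaginDual.ext h)
    refine ⟨_, ⟨conjChar γ 1, Algebra.subset_adjoin ⟨γ, rfl⟩, rfl⟩, ?_⟩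
    intro h
    apply hγ
    have h' : (starRingEnd ℂ) (ξ γ : ℂ) = (starRingEnd ℂ) (η γ : ℂ) := by
      simpa [conjChar] using h
    exact Circle.ext ((starRingEnd ℂ).injective h')
  have hspan : Subalgebra.toSubmodule A.toSubalgebra =
      Submodule.span ℂ (Set.range fun γ : Γ => conjChar γ (1 : ℂ)) := by
    refine Algebra.adjoin_eq_span_of_subset _ (subset_trans ?_ Submodule.subset_span)
    intro f hf
    induction hf using Submonoid.closure_induction with
    | mem f hf => exact hf
    | one => exact ⟨1, by ext ξ; simp [conjChar]⟩
    | mul f g _ _ hf hg =>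
      obtain ⟨a, rfl⟩ := hf
      obtain ⟨b, rfl⟩ := hg
      exact ⟨a * b, by ext ξ; simp [conjChar]⟩
  rw [← hspan]
  exact congr_arg (Subalgebra.toSubmodule <| StarSubalgebra.toSubalgebra ·) hA

theorem span_charEmbedding_dense :
    (Submodule.span ℂ (Set.range fun γ : Γ => charEmbedding γ (1 : ℂ))).topologicalClosure = ⊤ := by
  have h := (ContinuousMap.toLp_denseRange ℂ (dualHaar Γ) ℂ
    (p := 2) (by simp)).topologicalClosure_map_submodule (span_conjChar_dense (Γ := Γ))
  rw [← h, Submodule.map_span, ← Set.range_comp]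
  congr 3

theorem total_charEmbedding :
    ⊤ ≤ (⨆ γ : Γ, (charEmbedding (H := H) γ).toLinearMap.range).topologicalClosure := by
  set S := ⨆ γ : Γ, (charEmbedding (H := H) γ).toLinearMap.range with hS
  rintro f -
  refine Lp.induction (p := 2) (by simp) (motive := fun f => f ∈ S.topologicalClosure)
    ?_ ?_ ?_ f
  · intro c s hs hμ
    let L : Lp ℂ 2 (dualHaar Γ) →L[ℂ] Lp H 2 (dualHaar Γ) :=
      (ContinuousLinearMap.toSpanSingleton ℂ c).compLpL 2 (dualHaar Γ)
    have hL : ∀ g : Lp ℂ 2 (dualHaar Γ), L g ∈ S.topologicalClosure := by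
      intro g
      have hg : g ∈ (Submodule.span ℂ
          (Set.range fun γ : Γ => charEmbedding γ (1 : ℂ))).topologicalClosure := by
        rw [span_charEmbedding_dense]; trivial
      have hle : Submodule.span ℂ (Set.range fun γ : Γ => charEmbedding γ (1 : ℂ)) ≤
          (S.topologicalClosure).comap (L : Lp ℂ 2 (dualHaar Γ) →ₗ[ℂ] Lp H 2 (dualHaar Γ)) := by
        rw [Submodule.span_le]
        rintro - ⟨γ, rfl⟩
        apply Submodule.le_topologicalClosure
        refine Submodule.mem_iSup_of_mem γ ⟨c, ?_⟩
        apply Lp.ext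
        have e1 := charEmbedding_coeFn γ c
        have e2 := charEmbedding_coeFn γ (1 : ℂ)
        have e3 := (ContinuousLinearMap.toSpanSingleton ℂ c).coeFn_compLp
          (charEmbedding γ (1 : ℂ) : Lp ℂ 2 (dualHaar Γ))
        filter_upwards [e1, e2, e3] with ξ e1 e2 e3
        refine e1.trans (Eq.trans ?_ e3.symm)
        rw [e2]
        simp [conjChar]
      have hcl : IsClosed ((S.topologicalClosure).comap
          (L : Lp ℂ 2 (dualHaar Γ) →ₗ[ℂ] Lp H 2 (dualHaar Γ)) : Set (Lp ℂ 2 (dualHaar Γ))) :=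
        (Submodule.isClosed_topologicalClosure S).preimage L.continuous
      exact Submodule.topologicalClosure_minimal _ hle hcl hg
    have key := hL (indicatorConstLp 2 hs hμ.ne (1 : ℂ))
    convert key using 1
    apply Lp.ext
    have e1 := indicatorConstLp_coeFn (p := 2) (hs := hs) (hμs := hμ.ne) (c := c)
    have e2 := indicatorConstLp_coeFn (p := 2) (hs := hs) (hμs := hμ.ne) (c := (1 : ℂ))
    have e3 := (ContinuousLinearMap.toSpanSingleton ℂ c).coeFn_compLp
      (indicatorConstLp 2 hs hμ.ne (1 : ℂ))
    filter_upwards [e1, e2, e3] with ξ e1 e2 e3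
    refine Eq.trans ?_ e3.symm
    rw [e2]
    refine e1.trans ?_
    by_cases h : ξ ∈ s <;> simp [h]
  · intro f g hf hg _ h1 h2
    exact Submodule.add_mem _ h1 h2
  · exact Submodule.isClosed_topologicalClosure S

variable [CompleteSpace H]

theorem isHilbertSum_charEmbedding :
    IsHilbertSum ℂ (fun _ : Γ => H) (fun γ : Γ => charEmbedding (H := H) γ) :=
  IsHilbertSum.mk orthogonalFamily_charEmbedding total_charEmbedding

variable (Γ H) in
/-- The Fourier transform `F_H : ℓ²(Γ, H) → L²(Γ̂, H)`: the unitary operator that maps the sequence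
supported at `γ` with value `x` to the function `ξ ↦ conj (ξ γ) • x`. -/
noncomputable def fourierOp : lp (fun _ : Γ => H) 2 ≃ₗᵢ[ℂ] Lp H 2 (dualHaar Γ) :=
  (isHilbertSum_charEmbedding (Γ := Γ) (H := H)).linearIsometryEquiv.symm

/-- On `ℓ¹ ∩ ℓ²` the Fourier transform is given by the usual formula. -/
theorem fourierOp_apply_of_summable [SecondCountableTopology H] (f : lp (fun _ : Γ => H) 2) (hf : Summable fun γ => ‖f γ‖) :
    fourierOp Γ H f =ᵐ[dualHaar Γ] fun ξ => ∑' γ, (starRingEnd ℂ) (ξ γ : ℂ) • f γ := by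
  have hs : Summable fun γ => conjChar γ (f γ) := by
    refine Summable.of_norm_bounded hf fun γ => ?_
    refine (ContinuousMap.norm_le _ (norm_nonneg _)).2 fun ξ => ?_
    exact (norm_conjChar_apply γ (f γ) ξ).le
  have h1 := (ContinuousMap.toLp 2 (dualHaar Γ) ℂ (E := H)).hasSum hs.hasSum
  have h2 := (isHilbertSum_charEmbedding (Γ := Γ) (H := H)).hasSum_linearIsometryEquiv_symm f
  have h3 : fourierOp Γ H f = ContinuousMap.toLp 2 (dualHaar Γ) ℂ (∑' γ, conjChar γ (f γ)) :=
    h2.unique h1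
  rw [h3]
  filter_upwards [ContinuousMap.coeFn_toLp (p := 2) (𝕜 := ℂ) (dualHaar Γ)
    (∑' γ, conjChar γ (f γ))] with ξ hξ
  rw [hξ]
  exact (ContinuousMap.hasSum_apply hs.hasSum ξ).tsum_eq.symm

end Fourier

section Multiplication

variable {H K : Type*} [NormedAddCommGroup H] [InnerProductSpace ℂ H]
  [NormedAddCommGroup K] [InnerProductSpace ℂ K]

/-- The multiplication operator `M_Φ : L²(Γ̂, H) → L²(Γ̂, K)` of an operator-valued function
`Φ ∈ L^∞(Γ̂, B(H, K))`. -/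
noncomputable def mulOp (Φ : Lp (H →L[ℂ] K) ∞ (dualHaar Γ)) :
    Lp H 2 (dualHaar Γ) →L[ℂ] Lp K 2 (dualHaar Γ) :=
  (ContinuousLinearMap.id ℂ (H →L[ℂ] K)).holderL (dualHaar Γ) ∞ 2 2 Φ

theorem mulOp_apply (Φ : Lp (H →L[ℂ] K) ∞ (dualHaar Γ)) (f : Lp H 2 (dualHaar Γ)) :
    mulOp Φ f =ᵐ[dualHaar Γ] fun ξ => Φ ξ (f ξ) :=
  (ContinuousLinearMap.id ℂ (H →L[ℂ] K)).coeFn_holder (r := 2) Φ f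

end Multiplication

end Dual

/-! ### Twists by a unitary representation -/

section Twist

variable {Γ : Type*} [Group Γ] {H : Type*} [NormedAddCommGroup H] [InnerProductSpace ℂ H]

theorem memlp_rotate (u : Γ → (H ≃ₗᵢ[ℂ] H)) {f : Γ → H} (hf : Memℓp f 2) :
    Memℓp (fun γ => u γ (f γ)) 2 := by
  refine (memℓp_gen_iff (p := 2) (by simp)).2 ?_
  have h := (memℓp_gen_iff (p := 2) (by simp)).1 hf
  simpa only [LinearIsometryEquiv.norm_map] using h

/-- The unitary operator `T_π` on `ℓ²(Γ, H)` with `(T_π f) γ = π(γ⁻¹) (f γ)`, for a unitary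
representation `π` of `Γ` on `H`. -/
noncomputable def twist (π : Γ →* (H ≃ₗᵢ[ℂ] H)) :
    lp (fun _ : Γ => H) 2 ≃ₗᵢ[ℂ] lp (fun _ : Γ => H) 2 where
  toFun f := ⟨fun γ => π γ⁻¹ (f γ), memlp_rotate (fun γ => π γ⁻¹) (lp.memℓp f)⟩
  invFun f := ⟨fun γ => π γ (f γ), memlp_rotate (fun γ => π γ) (lp.memℓp f)⟩
  map_add' f g := lp.ext (funext fun γ => map_add (π γ⁻¹) (f γ) (g γ))
  map_smul' c f := lp.ext (funext fun γ => map_smul (π γ⁻¹) c (f γ))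
  left_inv f := lp.ext (funext fun γ => by
    change π γ (π γ⁻¹ (f γ)) = f γ
    rw [map_inv]
    exact (π γ).apply_symm_apply (f γ))
  right_inv f := lp.ext (funext fun γ => by
    change π γ⁻¹ (π γ (f γ)) = f γ
    rw [map_inv]
    exact (π γ).symm_apply_apply (f γ))
  norm_map' f := by
    simp [lp.norm_eq_tsum_rpow (p := 2) (by simp)]

end Twist

/-! ### Free actions and the associated reshaping of `ℓ²` -/

section Orbits

variable {Γ S : Type*} [Group Γ]

/-- Points are equivalent when they lie in the same orbit of the action `ρ`. -/
def orbitSetoid (ρ : Γ →* Equiv.Perm S) : Setoid S where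
  r s t := ∃ γ, ρ γ s = t
  iseqv :=
    { refl := fun s => ⟨1, by simp⟩
      symm := by
        rintro s t ⟨γ, rfl⟩
        exact ⟨γ⁻¹, by simp⟩
      trans := by
        rintro s t u ⟨γ, rfl⟩ ⟨δ, rfl⟩
        exact ⟨δ * γ, by simp⟩ }

/-- The set of orbits of an action. -/
abbrev Orbits (ρ : Γ →* Equiv.Perm S) : Type _ := Quotient (orbitSetoid ρ)

/-- The action is free: no non-identity element fixes a point. -/
def IsFreeAction (ρ : Γ →* Equiv.Perm S) : Prop :=
  ∀ γ : Γ, γ ≠ 1 → ∀ s : S, ρ γ s ≠ s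

/-- The bijection `(γ, o) ↦ γ õ` from `Γ × S₀` to `S`, where `õ = rep o` is the chosen
representative of the orbit `o`. -/
noncomputable def orbitEquiv (ρ : Γ →* Equiv.Perm S) (hρ : IsFreeAction ρ)
    (rep : Orbits ρ → S) (hrep : ∀ o : Orbits ρ, Quotient.mk _ (rep o) = o) :
    Γ × Orbits ρ ≃ S :=
  Equiv.ofBijective (fun x => ρ x.1 (rep x.2)) (by
    constructor
    · rintro ⟨γ, o⟩ ⟨δ, o'⟩ h
      have h : ρ γ (rep o) = ρ δ (rep o') := h
      have h1 : ρ (δ⁻¹ * γ) (rep o) = rep o' := by simp [h]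
      have h2 : o = o' := by
        rw [← hrep o, ← hrep o']
        exact Quotient.sound ⟨_, h1⟩
      subst h2
      have h3 : δ⁻¹ * γ = 1 := by
        by_contra hne
        exact hρ _ hne _ h1
      rw [inv_mul_eq_one] at h3
      rw [h3]
    · intro s
      obtain ⟨γ, hγ⟩ := Quotient.exact (hrep (Quotient.mk (orbitSetoid ρ) s))
      exact ⟨(γ, Quotient.mk _ s), hγ⟩)

variable {S₀ W : Type*} [Fintype S₀] [NormedAddCommGroup W] [InnerProductSpace ℂ W]

theorem summable_stack (β : Γ × S₀ ≃ S) {z : S → W} (hz : Memℓp z 2) :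
    Summable fun x : Γ × S₀ => ‖z (β x)‖ ^ 2 := by
  have h := (memℓp_gen_iff (p := 2) (by simp)).1 hz
  have h' : Summable fun s => ‖z s‖ ^ 2 := by simpa using h
  exact β.summable_iff.2 h'

/-- For a bijection `β : Γ × S₀ ≃ S` with `S₀` finite, the isometric isomorphism
`ℓ²(S, W) ≃ ℓ²(Γ, W^{S₀})` that maps `z` to `γ ↦ (z (β (γ, o)))_{o ∈ S₀}`. -/
noncomputable def stack (β : Γ × S₀ ≃ S) :
    lp (fun _ : S => W) 2 ≃ₗᵢ[ℂ] lp (fun _ : Γ => PiLp 2 (fun _ : S₀ => W)) 2 where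
  toFun z := ⟨fun γ => WithLp.toLp 2 fun o => z (β (γ, o)), by
    refine (memℓp_gen_iff (p := 2) (by simp)).2 ?_
    have h := (summable_stack β (lp.memℓp z)).prod
    simpa [PiLp.norm_sq_eq_of_L2] using h⟩
  invFun f := ⟨fun s => f (β.symm s).1 (β.symm s).2, by
    refine (memℓp_gen_iff (p := 2) (by simp)).2 ?_
    have h := (memℓp_gen_iff (p := 2) (by simp)).1 (lp.memℓp f)
    have h' : Summable fun γ => ∑' o, ‖f γ o‖ ^ 2 := by
      simpa [PiLp.norm_sq_eq_of_L2] using h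
    have h2 : Summable fun x : Γ × S₀ => ‖f x.1 x.2‖ ^ 2 :=
      (summable_prod_of_nonneg fun x => by positivity).2
        ⟨fun γ => Summable.of_finite, h'⟩
    simpa [Function.comp_def] using β.symm.summable_iff.2 h2⟩
  map_add' y z := lp.ext (funext fun γ => rfl)
  map_smul' c z := lp.ext (funext fun γ => rfl)
  left_inv z := by ext s; simp
  right_inv f := by ext γ o; simp
  norm_map' z := by
    have h := summable_stack β (lp.memℓp z)
    have h1 : ∑' γ, ∑' o, ‖z (β (γ, o))‖ ^ 2 = ∑' s, ‖z s‖ ^ 2 := by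
      rw [← h.tsum_prod, β.tsum_eq (fun s => ‖z s‖ ^ 2)]
    simp [lp.norm_eq_tsum_rpow (p := 2) (by simp), PiLp.norm_sq_eq_of_L2] at h1 ⊢
    rw [h1]

end Orbits

/-! ### Frameworks -/

section Frameworks

variable {V : Type*}

/-- A framework for `X` and `Y` on the simple graph `G`: linear maps `φ v w : X → Y` that vanish
when `vw` is not an edge and satisfy `φ v w = - φ w v` on edges. -/
structure Framework (G : SimpleGraph V) (X Y : Type*)
    [NormedAddCommGroup X] [InnerProductSpace ℂ X]
    [NormedAddCommGroup Y] [InnerProductSpace ℂ Y] where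
  φ : V → V → X →ₗ[ℂ] Y
  eq_zero : ∀ v w, ¬ G.Adj v w → φ v w = 0
  antisymm : ∀ v w, G.Adj v w → φ v w = - φ w v

variable {G : SimpleGraph V} {X Y : Type*}
  [NormedAddCommGroup X] [InnerProductSpace ℂ X]
  [NormedAddCommGroup Y] [InnerProductSpace ℂ Y]

/-- The linear map `X^V → Y^E` of the coboundary matrix, whose row at the edge `vw` has the entries
`φ v w` at `v`, `φ w v = - φ v w` at `w` and zero elsewhere. -/
def Framework.coboundary (𝓕 : Framework G X Y) : (V → X) →ₗ[ℂ] (G.edgeSet → Y) where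
  toFun x e := Sym2.lift ⟨fun v w => 𝓕.φ v w (x v - x w), fun v w => by
    by_cases h : G.Adj v w
    · simp [𝓕.antisymm v w h]
    · simp [𝓕.eq_zero v w h, 𝓕.eq_zero w v (fun h' => h h'.symm)]⟩ (e : Sym2 V)
  map_add' x y := by
    ext ⟨e, he⟩
    induction e using Sym2.ind with
    | h v w => simp; abel
  map_smul' c x := by
    ext ⟨e, he⟩
    induction e using Sym2.ind with
    | h v w => simp [smul_sub]

variable {Γ : Type*} [Group Γ]

/-- The action on vertices of a group acting by graph automorphisms. -/
def vertexAction (θ : Γ →* (G ≃g G)) : Γ →* Equiv.Perm V where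
  toFun γ := (θ γ).toEquiv
  map_one' := by ext v; simp
  map_mul' γ δ := by ext v; simp

/-- The induced action on edges, `γ (vw) = (γ v) (γ w)`. -/
def edgeAction (θ : Γ →* (G ≃g G)) : Γ →* Equiv.Perm G.edgeSet where
  toFun γ := (θ γ).mapEdgeSet
  map_one' := by
    ext ⟨e, he⟩
    induction e using Sym2.ind with
    | h v w => simp
  map_mul' γ δ := by
    ext ⟨e, he⟩
    induction e using Sym2.ind with
    | h v w => simp

/-- A gain graph for `(G, θ)`: a representative vertex `ṽ` of every vertex orbit, and for every edge
orbit an orientation `(src, tgt)`, a gain `γ` and the representative edge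
`ẽ = ṽ (γ w̃)`, where `v = src`, `w = tgt`. -/
structure GainGraph (θ : Γ →* (G ≃g G)) where
  vRep : Orbits (vertexAction θ) → V
  vRep_mem : ∀ o : Orbits (vertexAction θ), Quotient.mk _ (vRep o) = o
  src : Orbits (edgeAction θ) → Orbits (vertexAction θ)
  tgt : Orbits (edgeAction θ) → Orbits (vertexAction θ)
  gain : Orbits (edgeAction θ) → Γ
  eRep : Orbits (edgeAction θ) → G.edgeSet
  eRep_eq : ∀ o, (eRep o : Sym2 V) = s(vRep (src o), θ (gain o) (vRep (tgt o)))
  eRep_mem : ∀ o : Orbits (edgeAction θ), Quotient.mk _ (eRep o) = o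

/-- The linear part `dτ` of a homomorphism `τ` into the affine isometries of `X`. -/
noncomputable def linearPart (τ : Γ →* (X ≃ᵃⁱ[ℂ] X)) : Γ →* (X ≃ₗᵢ[ℂ] X) where
  toFun γ := (τ γ).linearIsometryEquiv
  map_one' := by rw [map_one]; rfl
  map_mul' γ δ := by rw [map_mul]; rfl

/-- The unitary representation `γ ↦ ((x_o)_o ↦ (π(γ) x_o)_o)` on `X^{S₀}`. -/
noncomputable def diagonalRep (S₀ : Type*) [Fintype S₀] (π : Γ →* (X ≃ₗᵢ[ℂ] X)) :
    Γ →* (PiLp 2 (fun _ : S₀ => X) ≃ₗᵢ[ℂ] PiLp 2 (fun _ : S₀ => X)) where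
  toFun γ := LinearIsometryEquiv.piLpCongrRight 2 fun _ => π γ
  map_one' := by ext x o; simp
  map_mul' γ δ := by ext x o; simp

/-- A `Γ`-symmetric framework `(G, φ, θ, τ)`. The maps `φ v w` are applied to differences of
points, so the affine isometries `τ γ` enter the compatibility condition through their linear
parts. -/
structure SymmetricFramework (Γ : Type*) [Group Γ] {V : Type*} (G : SimpleGraph V) (X Y : Type*)
    [NormedAddCommGroup X] [InnerProductSpace ℂ X]
    [NormedAddCommGroup Y] [InnerProductSpace ℂ Y] extends Framework G X Y where
  θ : Γ →* (G ≃g G)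
  τ : Γ →* (X ≃ᵃⁱ[ℂ] X)
  compat : ∀ (γ : Γ) (v w : V) (x : X),
    φ (θ γ v) (θ γ w) x = φ v w (linearPart τ γ⁻¹ x)

end Frameworks

section Operators

variable {Γ : Type*} [Group Γ] {V : Type*} {G : SimpleGraph V} {X Y : Type*}
  [NormedAddCommGroup X] [InnerProductSpace ℂ X]
  [NormedAddCommGroup Y] [InnerProductSpace ℂ Y]

namespace SymmetricFramework

/-- The set `V₀` of vertex orbits. -/
abbrev V₀ (𝓖 : SymmetricFramework Γ G X Y) : Type _ := Orbits (vertexAction 𝓖.θ)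

/-- The set `E₀` of edge orbits. -/
abbrev E₀ (𝓖 : SymmetricFramework Γ G X Y) : Type _ := Orbits (edgeAction 𝓖.θ)

variable (𝓖 : SymmetricFramework Γ G X Y)

/-- The Hilbert space `X^{V₀}`. -/
abbrev XV₀ [Fintype 𝓖.V₀] : Type _ := PiLp 2 (fun _ : 𝓖.V₀ => X)

/-- The Hilbert space `Y^{E₀}`. -/
abbrev YE₀ [Fintype 𝓖.E₀] : Type _ := PiLp 2 (fun _ : 𝓖.E₀ => Y)

/-- The unitary representation `τ̃` of `Γ` on `X^{V₀}`, `τ̃(γ) x = (dτ(γ) x_{[v]})_{[v] ∈ V₀}`. -/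
noncomputable def tauTilde [Fintype 𝓖.V₀] : Γ →* (𝓖.XV₀ ≃ₗᵢ[ℂ] 𝓖.XV₀) :=
  diagonalRep 𝓖.V₀ (linearPart 𝓖.τ)

/-- The isometric isomorphism `S_V`, `S_V(z)_γ = (z_{γ ṽ})_{[v] ∈ V₀}`. -/
noncomputable def opSV [Fintype 𝓖.V₀] (hV : IsFreeAction (vertexAction 𝓖.θ))
    (g : GainGraph 𝓖.θ) :
    lp (fun _ : V => X) 2 ≃ₗᵢ[ℂ] lp (fun _ : Γ => 𝓖.XV₀) 2 :=
  stack (orbitEquiv (vertexAction 𝓖.θ) hV g.vRep g.vRep_mem)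

/-- The isometric isomorphism `S_E`, `S_E(z)_γ = (z_{γ ẽ})_{[e] ∈ E₀}`. -/
noncomputable def opSE [Fintype 𝓖.E₀] (hE : IsFreeAction (edgeAction 𝓖.θ))
    (g : GainGraph 𝓖.θ) :
    lp (fun _ : G.edgeSet => Y) 2 ≃ₗᵢ[ℂ] lp (fun _ : Γ => 𝓖.YE₀) 2 :=
  stack (orbitEquiv (edgeAction 𝓖.θ) hE g.eRep g.eRep_mem)

end SymmetricFramework

end Operators

end SymbolFunction

open SymbolFunction

/-! The twist turns equivariance into translation invariance. Put `f = T S_V z`, so that `f(γ)_[v] =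
dτ(γ⁻¹) z_{γṽ}`, and let `ẽ = ṽ(δw̃)` be a representative edge. The compatibility condition moves
`φ` from `γẽ` back to `ẽ` at the cost of `dτ(γ⁻¹)`, and `dτ(γ⁻¹) = dτ(δ) dτ((γδ)⁻¹)`. The coboundary
at `γẽ` is therefore `φ_{ṽ,δw̃}(f(γ)_[v] - dτ(δ) f(γδ)_[w])`; this is `coboundary_edgeAction_eRep`.

The coefficients no longer depend on `γ`, so in terms of `f` the operator is a finite sum (over the
edge orbits) of translations of `Γ` followed by constant block operators. The Fourier transform
turns a translation into multiplication by a character (`fourierOp_symm_mulOp_charSymbol`). The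
symbol is thus a trigonometric polynomial with operator coefficients, which is bounded. Boundedness
of the coboundary operator on `ℓ²` follows from the factorisation. -/

namespace SymbolFunction

/-! ### Character symbols and translations -/

section Character

variable {Γ : Type*} [CommGroup Γ] [TopologicalSpace Γ] [DiscreteTopology Γ]
  {H K : Type*} [NormedAddCommGroup H] [InnerProductSpace ℂ H]
  [NormedAddCommGroup K] [InnerProductSpace ℂ K]

theorem memLp_top_conjChar (γ : Γ) (B : H →L[ℂ] K) : MemLp (conjChar γ B) ∞ (dualHaar Γ) := by
  refine MemLp.of_bound ?_ ‖B‖ (Filter.Eventually.of_forall fun ξ => ?_)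
  · exact (Complex.continuous_conj.comp (continuous_eval γ)).aestronglyMeasurable.smul_const B
  · exact (norm_conjChar_apply γ B ξ).le

/-- The symbol `ξ ↦ conj (ξ γ) • B` in `L^∞(Γ̂, B(H, K))`. -/
noncomputable def charSymbol (γ : Γ) (B : H →L[ℂ] K) : Lp (H →L[ℂ] K) ∞ (dualHaar Γ) :=
  (memLp_top_conjChar γ B).toLp _

theorem mulOp_sub (Φ Ψ : Lp (H →L[ℂ] K) ∞ (dualHaar Γ)) : mulOp (Φ - Ψ) = mulOp Φ - mulOp Ψ :=
  map_sub _ Φ Ψ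

theorem mulOp_sum {ι : Type*} (s : Finset ι) (Φ : ι → Lp (H →L[ℂ] K) ∞ (dualHaar Γ)) :
    mulOp (∑ i ∈ s, Φ i) = ∑ i ∈ s, mulOp (Φ i) :=
  map_sum _ Φ s

/-- Pointwise this is multiplicativity of characters in the group variable, with the constant
operator `B` passing through the scalar. It is the translation rule on the Fourier side for
sequences supported at one point. -/
theorem mulOp_charSymbol_charEmbedding (γ δ : Γ) (B : H →L[ℂ] K) (x : H) :
    mulOp (charSymbol γ B) (charEmbedding δ x) = charEmbedding (γ * δ) (B x) := by
  apply Lp.ext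
  filter_upwards [mulOp_apply (charSymbol γ B) (charEmbedding δ x),
    (memLp_top_conjChar γ B).coeFn_toLp, charEmbedding_coeFn δ x,
    charEmbedding_coeFn (γ * δ) (B x)] with ξ h1 h2 h3 h4
  rw [h1, h3, h4, charSymbol, h2]
  simp [conjChar, smul_smul, mul_comm]

variable [CompleteSpace H] [CompleteSpace K]

theorem fourierOp_single [DecidableEq Γ] (γ : Γ) (x : H) :
    fourierOp Γ H (lp.single 2 γ x) = charEmbedding γ x :=
  (isHilbertSum_charEmbedding (Γ := Γ) (H := H)).linearIsometryEquiv_symm_apply_single x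

/-- Under the Fourier transform, multiplication by a character times a constant operator `B`
corresponds to a translation followed by `B`. -/
theorem fourierOp_symm_mulOp_charSymbol (γ : Γ) (B : H →L[ℂ] K) (f : lp (fun _ : Γ => H) 2)
    (δ : Γ) :
    (fourierOp Γ K).symm (mulOp (charSymbol γ B) (fourierOp Γ H f)) δ = B (f (γ⁻¹ * δ)) := by
  classical
  let L : lp (fun _ : Γ => H) 2 →L[ℂ] K :=
    lp.evalCLM ℂ (fun _ : Γ => K) 2 δ ∘L (fourierOp Γ K).symm.toContinuousLinearEquiv ∘L
      mulOp (charSymbol γ B) ∘L (fourierOp Γ H).toContinuousLinearEquiv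
  let R : lp (fun _ : Γ => H) 2 →L[ℂ] K := B ∘L lp.evalCLM ℂ (fun _ : Γ => H) 2 (γ⁻¹ * δ)
  -- `L` and `R` are the two sides as bounded linear maps of `f`. Sequences supported at one point
  -- suffice, because every `f` is the `ℓ²` sum of its one-point parts.
  have hsingle : ∀ (α : Γ) (x : H), L (lp.single 2 α x) = R (lp.single 2 α x) := by
    intro α x
    change (fourierOp Γ K).symm (mulOp (charSymbol γ B) (fourierOp Γ H (lp.single 2 α x))) δ =
      B (lp.single (E := fun _ : Γ => H) 2 α x (γ⁻¹ * δ))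
    rw [fourierOp_single, mulOp_charSymbol_charEmbedding, ← fourierOp_single,
      LinearIsometryEquiv.symm_apply_apply, lp.single_apply, lp.single_apply]
    by_cases h : δ = γ * α
    · subst h
      simp
    · rw [Pi.single_eq_of_ne h, Pi.single_eq_of_ne (fun h' => h (inv_mul_eq_iff_eq_mul.1 h')),
        map_zero]
  have hf := lp.hasSum_single (p := 2) (by simp) f
  have hL := hf.mapL L
  simp only [hsingle] at hL
  exact hL.unique (hf.mapL R)

end Character

/-! ### The coboundary along edge orbits -/

section Coboundary

variable {Γ : Type*} [Group Γ] {V : Type*} {G : SimpleGraph V} {X Y : Type*}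
  [NormedAddCommGroup X] [InnerProductSpace ℂ X]
  [NormedAddCommGroup Y] [InnerProductSpace ℂ Y]

theorem stack_symm_apply {S S₀ W : Type*} [Fintype S₀] [NormedAddCommGroup W]
    [InnerProductSpace ℂ W] (β : Γ × S₀ ≃ S)
    (f : lp (fun _ : Γ => PiLp 2 (fun _ : S₀ => W)) 2) (γ : Γ) (o : S₀) :
    (stack β).symm f (β (γ, o)) = f γ o := by
  change f (β.symm (β (γ, o))).1 (β.symm (β (γ, o))).2 = f γ o
  rw [β.symm_apply_apply]

/-- Edges are unordered pairs, so the row of an edge may be computed in either orientation; the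
orientation supplied by the gain graph is the one needed later. -/
theorem Framework.coboundary_mk (𝓕 : Framework G X Y) (x : V → X) {v w : V} {e : G.edgeSet}
    (h : (e : Sym2 V) = s(v, w)) : 𝓕.coboundary x e = 𝓕.φ v w (x v - x w) := by
  obtain ⟨e, he⟩ := e
  subst h
  rfl

namespace SymmetricFramework

variable (𝓖 : SymmetricFramework Γ G X Y)

theorem twist_opSV_apply [Fintype 𝓖.V₀] (hV : IsFreeAction (vertexAction 𝓖.θ))
    (g : GainGraph 𝓖.θ) (z : lp (fun _ : V => X) 2) (γ : Γ) (o : 𝓖.V₀) :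
    twist 𝓖.tauTilde (𝓖.opSV hV g z) γ o = linearPart 𝓖.τ γ⁻¹ (z (𝓖.θ γ (g.vRep o))) :=
  rfl

theorem coe_edgeAction_eRep (g : GainGraph 𝓖.θ) (γ : Γ) (o : 𝓖.E₀) :
    (edgeAction 𝓖.θ γ (g.eRep o) : Sym2 V) =
      s(𝓖.θ γ (g.vRep (g.src o)), 𝓖.θ (γ * g.gain o) (g.vRep (g.tgt o))) := by
  change Sym2.map (𝓖.θ γ) (g.eRep o : Sym2 V) = _
  rw [g.eRep_eq, Sym2.map_mk, map_mul]
  rfl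

/-- The coboundary at the edge `γ ẽ`, in terms of the maps at the representative edge `ẽ`. -/
theorem coboundary_edgeAction_eRep (g : GainGraph 𝓖.θ) (x : V → X) (γ : Γ) (o : 𝓖.E₀) :
    𝓖.coboundary x (edgeAction 𝓖.θ γ (g.eRep o)) =
      𝓖.φ (g.vRep (g.src o)) (𝓖.θ (g.gain o) (g.vRep (g.tgt o)))
        (linearPart 𝓖.τ γ⁻¹ (x (𝓖.θ γ (g.vRep (g.src o)))) -
          linearPart 𝓖.τ (g.gain o) (linearPart 𝓖.τ (γ * g.gain o)⁻¹
            (x (𝓖.θ (γ * g.gain o) (g.vRep (g.tgt o)))))) := by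
  -- The product collapses to `dτ(γ⁻¹)`. It is kept split in the statement because the inner factor
  -- is exactly the twist at the group element `γ * g.gain o`.
  have h : ∀ y, linearPart 𝓖.τ (g.gain o) (linearPart 𝓖.τ (γ * g.gain o)⁻¹ y) =
      linearPart 𝓖.τ γ⁻¹ y := by
    intro y
    have h' : linearPart 𝓖.τ (g.gain o) * linearPart 𝓖.τ (γ * g.gain o)⁻¹ =
        linearPart 𝓖.τ γ⁻¹ := by
      rw [← map_mul, mul_inv_rev, mul_inv_cancel_left]
    exact DFunLike.congr_fun h' y
  rw [𝓖.coboundary_mk x (𝓖.coe_edgeAction_eRep g γ o), h, ← map_sub, ← 𝓖.compat, map_mul]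
  rfl

end SymmetricFramework

end Coboundary

/-! ### Block operators and the symbol function -/

section Symbol

variable {X Y : Type*} [NormedAddCommGroup X] [InnerProductSpace ℂ X] [FiniteDimensional ℂ X]
  [NormedAddCommGroup Y] [InnerProductSpace ℂ Y]

open Classical in
/-- The operator `X^S → Y^T` whose block matrix has `A` in the row `t` and the column `s` as its
only nonzero block. -/
noncomputable def blockSingle {S T : Type*} [Fintype S] [Fintype T] (t : T) (s : S)
    (A : X →ₗ[ℂ] Y) : PiLp 2 (fun _ : S => X) →L[ℂ] PiLp 2 (fun _ : T => Y) :=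
  (PiLp.continuousLinearEquiv 2 ℂ (fun _ : T => Y)).symm.toContinuousLinearMap ∘L
    ContinuousLinearMap.single ℂ (fun _ : T => Y) t ∘L
      LinearMap.toContinuousLinearMap A ∘L PiLp.proj 2 (fun _ : S => X) s

theorem blockSingle_apply_self {S T : Type*} [Fintype S] [Fintype T] (t : T) (s : S)
    (A : X →ₗ[ℂ] Y) (x : PiLp 2 (fun _ : S => X)) : blockSingle t s A x t = A (x s) := by
  classical
  change Pi.single (M := fun _ : T => Y) t (A (x s)) t = A (x s)
  convert Pi.single_eq_same (M := fun _ : T => Y) t (A (x s))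

theorem blockSingle_apply_of_ne {S T : Type*} [Fintype S] [Fintype T] {t t' : T} (h : t' ≠ t)
    (s : S) (A : X →ₗ[ℂ] Y) (x : PiLp 2 (fun _ : S => X)) : blockSingle t s A x t' = 0 := by
  classical
  change Pi.single (M := fun _ : T => Y) t (A (x s)) t' = 0
  convert Pi.single_eq_of_ne (M := fun _ : T => Y) h (A (x s))

namespace SymmetricFramework

variable {Γ : Type*} [CommGroup Γ] [TopologicalSpace Γ] [DiscreteTopology Γ]
  {V : Type*} {G : SimpleGraph V} (𝓖 : SymmetricFramework Γ G X Y)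

/-- The linear map of the framework at the representative edge of the orbit `o`. -/
noncomputable def repMap (g : GainGraph 𝓖.θ) (o : 𝓖.E₀) : X →ₗ[ℂ] Y :=
  𝓖.φ (g.vRep (g.src o)) (𝓖.θ (g.gain o) (g.vRep (g.tgt o)))

variable [Fintype 𝓖.V₀] [Fintype 𝓖.E₀]

/-- The symbol function of a symmetric framework. With `ẽ = ṽ (δ w̃)`, the row `[e]` of its value
at `ξ` maps `x` to `φ_{ṽ, δ w̃} (x_{[v]} - ξ(δ) dτ(δ) x_{[w]})`. -/
noncomputable def symbol (g : GainGraph 𝓖.θ) : Lp (𝓖.XV₀ →L[ℂ] 𝓖.YE₀) ∞ (dualHaar Γ) :=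
  ∑ o, (charSymbol 1 (blockSingle o (g.src o) (𝓖.repMap g o)) -
    -- The symbol `conj (ξ α)` sends `f` to `γ ↦ f (α⁻¹ γ)`, so evaluation at `γ δ` requires `α =
    -- δ⁻¹`. This gives the factor `conj (ξ δ⁻¹) = ξ δ`.
    charSymbol (g.gain o)⁻¹ (blockSingle o (g.tgt o)
      (𝓖.repMap g o ∘ₗ (linearPart 𝓖.τ (g.gain o)).toLinearEquiv.toLinearMap)))

theorem fourierOp_symm_mulOp_symbol [CompleteSpace X] [CompleteSpace Y] (g : GainGraph 𝓖.θ)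
    (f : lp (fun _ : Γ => 𝓖.XV₀) 2) (γ : Γ) (o : 𝓖.E₀) :
    (fourierOp Γ 𝓖.YE₀).symm (mulOp (𝓖.symbol g) (fourierOp Γ 𝓖.XV₀ f)) γ o =
      𝓖.repMap g o (f γ (g.src o) -
        linearPart 𝓖.τ (g.gain o) (f (γ * g.gain o) (g.tgt o))) := by
  have h : ((fourierOp Γ 𝓖.YE₀).symm (mulOp (𝓖.symbol g) (fourierOp Γ 𝓖.XV₀ f)) :
      lp (fun _ : Γ => 𝓖.YE₀) 2) γ =
      ∑ p, (blockSingle p (g.src p) (𝓖.repMap g p) (f γ) - blockSingle p (g.tgt p)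
        (𝓖.repMap g p ∘ₗ (linearPart 𝓖.τ (g.gain p)).toLinearEquiv.toLinearMap)
          (f (γ * g.gain p))) := by
    -- Commutativity matters here: the translation rule yields `f (δ γ)`, whereas moving along an
    -- edge of gain `δ` yields `f (γ δ)`.
    simp only [symbol, mulOp_sum, mulOp_sub, sum_apply,
      sub_apply, map_sum, map_sub, lp.coeFn_sum, Finset.sum_apply,
      lp.coeFn_sub, Pi.sub_apply, fourierOp_symm_mulOp_charSymbol, inv_one, one_mul, inv_inv,
      mul_comm γ]
  -- Both blocks of the summand `p` lie in row `p`, so only `p = o` contributes to the component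
  -- `o`.
  rw [h, WithLp.ofLp_sum, Finset.sum_apply, Finset.sum_eq_single o]
  · rw [WithLp.ofLp_sub, Pi.sub_apply, blockSingle_apply_self, blockSingle_apply_self, map_sub]
    rfl
  · intro p _ hp
    rw [WithLp.ofLp_sub, Pi.sub_apply, blockSingle_apply_of_ne hp.symm,
      blockSingle_apply_of_ne hp.symm, sub_zero]
  · intro ho
    exact absurd (Finset.mem_univ o) ho

/-- The operator with symbol function `𝓖.symbol g` is the coboundary operator on `ℓ²`. -/
theorem opSE_symm_symbol_apply [CompleteSpace X] [CompleteSpace Y]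
    (hV : IsFreeAction (vertexAction 𝓖.θ)) (hE : IsFreeAction (edgeAction 𝓖.θ))
    (g : GainGraph 𝓖.θ) (z : lp (fun _ : V => X) 2) (e : G.edgeSet) :
    (𝓖.opSE hE g).symm ((fourierOp Γ 𝓖.YE₀).symm (mulOp (𝓖.symbol g) (fourierOp Γ 𝓖.XV₀
      (twist 𝓖.tauTilde (𝓖.opSV hV g z))))) e = 𝓖.coboundary (fun v => z v) e := by
  -- Every edge is a translate `γ ẽ` of a representative, and at such an edge `S_E⁻¹` just reads off
  -- the component `o` at `γ`.
  obtain ⟨⟨γ, o⟩, rfl⟩ := (orbitEquiv (edgeAction 𝓖.θ) hE g.eRep g.eRep_mem).surjective e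
  rw [opSE, stack_symm_apply, fourierOp_symm_mulOp_symbol, twist_opSV_apply, twist_opSV_apply]
  exact (𝓖.coboundary_edgeAction_eRep g (fun v => z v) γ o).symm

end SymmetricFramework

end Symbol

end SymbolFunction

theorem theorem3p6
    {Γ : Type*} [CommGroup Γ] [TopologicalSpace Γ] [DiscreteTopology Γ]
    {V : Type*} [Countable V] {G : SimpleGraph V}
    {X : Type*} [NormedAddCommGroup X] [InnerProductSpace ℂ X]
    [CompleteSpace X] [FiniteDimensional ℂ X]
    {Y : Type*} [NormedAddCommGroup Y] [InnerProductSpace ℂ Y]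
    [CompleteSpace Y] [FiniteDimensional ℂ Y]
    (𝓖 : SymmetricFramework Γ G X Y)
    (hV : IsFreeAction (vertexAction 𝓖.θ)) (hE : IsFreeAction (edgeAction 𝓖.θ))
    [Fintype 𝓖.V₀] [Fintype 𝓖.E₀] (g : GainGraph 𝓖.θ) :
    ∃ C : lp (fun _ : V => X) 2 →L[ℂ] lp (fun _ : G.edgeSet => Y) 2,
      (∀ (z : lp (fun _ : V => X) 2) (e : G.edgeSet), C z e = 𝓖.coboundary (fun v => z v) e) ∧
      ∃ Φ : Lp (𝓖.XV₀ →L[ℂ] 𝓖.YE₀) ∞ (dualHaar Γ), ∀ z : lp (fun _ : V => X) 2,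
        C z = (𝓖.opSE hE g).symm ((fourierOp Γ 𝓖.YE₀).symm (mulOp Φ (fourierOp Γ 𝓖.XV₀
          (twist 𝓖.tauTilde (𝓖.opSV hV g z))))) := by
  -- `C` is defined as the factored composite, so it is bounded by construction. What remains is
  -- that its entries are those of the coboundary; the factorisation itself holds by definition.
  let C : lp (fun _ : V => X) 2 →L[ℂ] lp (fun _ : G.edgeSet => Y) 2 :=
    (𝓖.opSE hE g).symm.toContinuousLinearEquiv.toContinuousLinearMap ∘L
      (fourierOp Γ 𝓖.YE₀).symm.toContinuousLinearEquiv.toContinuousLinearMap ∘L mulOp (𝓖.symbol g) ∘L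
        (fourierOp Γ 𝓖.XV₀).toContinuousLinearEquiv.toContinuousLinearMap ∘L
          (twist 𝓖.tauTilde).toContinuousLinearEquiv.toContinuousLinearMap ∘L
            (𝓖.opSV hV g).toContinuousLinearEquiv.toContinuousLinearMap
  exact ⟨C, 𝓖.opSE_symm_symbol_apply hV hE g, 𝓖.symbol g, fun _ => rfl⟩
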